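/- **Theorem (Ramanujan).** The series below converges (absolutely, its terms being positive) and $$\sum_{k=0}^{\infty}\frac{\binom{4k}{2k}\binom{2k}{k}^{2}}{2^{8k}\,3^{2k}}\,(8k+1)=\frac{2\sqrt{3}}{\pi}.$$ -/

import Mathlib

open Filter Topology

/-! The series is the case m = 0 of a family S(m) = ∑ₖ `cubicTerm m k`. Telescoping
(`cubicAntidiff_succ_sub`) gives S(m) = (1 - (1/6)²/(m+1)²) S(m+1). On iteration the factors build
Euler's product for sin(π/6)/(π/6) = 3/π, while S(m) → ∑ₖ C(2k,k)/16ᵏ = 2/√3 by dominated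
convergence. -/

/-- The hypergeometric coefficient
`(1/2)_k² (3m + 1/2)_{2k} / ((m + 1)_k² (2k)! 9 ^ k)`, defined by its recurrence in `k`. -/
noncomputable def cubicCoeff (m : ℕ) : ℕ → ℝ
  | 0 => 1
  | k + 1 => cubicCoeff m k * (((k : ℝ) + 1 / 2) * (3 * m + 1 / 2 + 2 * k) *
      (3 * m + 3 / 2 + 2 * k) / (36 * ((m : ℝ) + 1 + k) ^ 2 * (k + 1)))

/-- The well-poised summand attached to `cubicCoeff`. -/
noncomputable def cubicTerm (m k : ℕ) : ℝ :=
  cubicCoeff m k * ((3 * m + 1 / 2 + 4 * k) / (3 * m + 1 / 2))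

/-- The antidifference certifying the contiguity relation between `m` and `m + 1`. -/
noncomputable def cubicAntidiff (m k : ℕ) : ℝ :=
  cubicCoeff m k * (k * (4 * k - 2) / ((3 * m + 1 / 2) * (3 * m + 3 / 2)))

lemma cubicCoeff_zero (m : ℕ) : cubicCoeff m 0 = 1 := rfl

lemma cubicCoeff_succ (m k : ℕ) :
    cubicCoeff m (k + 1) = cubicCoeff m k * (((k : ℝ) + 1 / 2) * (3 * m + 1 / 2 + 2 * k) *
      (3 * m + 3 / 2 + 2 * k) / (36 * ((m : ℝ) + 1 + k) ^ 2 * (k + 1))) := rfl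

lemma cubicCoeff_nonneg (m k : ℕ) : 0 ≤ cubicCoeff m k := by
  induction k with
  | zero => simp [cubicCoeff_zero]
  | succ k ih => rw [cubicCoeff_succ]; positivity

/-- Every ratio of consecutive coefficients is at most 9/36. Uniformity in m is what dominated
convergence needs. -/
lemma cubicCoeff_le (m k : ℕ) : cubicCoeff m k ≤ (1 / 4) ^ k := by
  induction k with
  | zero => simp [cubicCoeff_zero]
  | succ k ih =>
    rw [cubicCoeff_succ, pow_succ (1 / 4 : ℝ)]
    refine mul_le_mul ih ?_ (by positivity) (by positivity)
    rw [div_le_iff₀ (by positivity)]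
    have h : (3 * (m : ℝ) + 1 / 2 + 2 * k) * (3 * m + 3 / 2 + 2 * k)
        ≤ (3 * (m + 1 + k)) * (3 * (m + 1 + k)) := by
      apply mul_le_mul <;> first | positivity | linarith [(Nat.cast_nonneg k : (0 : ℝ) ≤ k)]
    have h' : (k : ℝ) + 1 / 2 ≤ k + 1 := by linarith
    calc ((k : ℝ) + 1 / 2) * (3 * m + 1 / 2 + 2 * k) * (3 * m + 3 / 2 + 2 * k)
        = ((k : ℝ) + 1 / 2) * ((3 * m + 1 / 2 + 2 * k) * (3 * m + 3 / 2 + 2 * k)) := by ring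
      _ ≤ (k + 1) * ((3 * (m + 1 + k)) * (3 * (m + 1 + k))) :=
        mul_le_mul h' h (by positivity) (by positivity)
      _ = 1 / 4 * (36 * ((m : ℝ) + 1 + k) ^ 2 * (k + 1)) := by ring

/-- Reduces the telescoping relation to an identity of rational functions in m and k. -/
lemma cubicCoeff_shift (m k : ℕ) :
    cubicCoeff (m + 1) k = cubicCoeff m k * ((3 * m + 1 / 2 + 2 * k) * (3 * m + 3 / 2 + 2 * k) *
      (3 * m + 5 / 2 + 2 * k) * (m + 1) ^ 2 / ((3 * m + 1 / 2) * (3 * m + 3 / 2) *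
      (3 * m + 5 / 2) * (m + 1 + k) ^ 2)) := by
  induction k with
  | zero =>
    simp only [cubicCoeff_zero, Nat.cast_zero]
    have : (3 * (m : ℝ) + 1 / 2) * (3 * m + 3 / 2) * (3 * m + 5 / 2) * (m + 1) ^ 2 ≠ 0 := by
      positivity
    simp only [mul_zero, add_zero, one_mul]
    rw [div_self this]
  | succ k ih =>
    rw [cubicCoeff_succ, ih, cubicCoeff_succ]
    push_cast
    rw [show (m : ℝ) + 1 + 1 + k = m + 1 + (k + 1) by ring]
    simp only [mul_assoc]
    congr 1
    rw [div_mul_div_comm, div_mul_div_comm, div_eq_div_iff (by positivity) (by positivity)]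
    ring

lemma cubicAntidiff_succ_sub (m k : ℕ) :
    cubicTerm m k - (1 - (1 / 6) ^ 2 / ((m : ℝ) + 1) ^ 2) * cubicTerm (m + 1) k
      = cubicAntidiff m (k + 1) - cubicAntidiff m k := by
  rw [cubicTerm, cubicTerm, cubicAntidiff, cubicAntidiff, cubicCoeff_succ, cubicCoeff_shift]
  push_cast
  have h1 : 6 * (m : ℝ) + 1 ≠ 0 := by positivity
  have h2 : 6 * (m : ℝ) + 3 ≠ 0 := by positivity
  have h3 : 6 * (m : ℝ) + 5 ≠ 0 := by positivity
  have h4 : 6 * (m : ℝ) + 7 ≠ 0 := by positivity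
  have h5 : (m : ℝ) + 1 + k ≠ 0 := by positivity
  have h6 : (m : ℝ) + 1 ≠ 0 := by positivity
  have h7 : (k : ℝ) + 1 ≠ 0 := by positivity
  rw [show 3 * (m : ℝ) + 1 / 2 = (6 * m + 1) / 2 by ring,
    show 3 * (m : ℝ) + 3 / 2 = (6 * m + 3) / 2 by ring,
    show 3 * (m : ℝ) + 5 / 2 = (6 * m + 5) / 2 by ring,
    show 3 * ((m : ℝ) + 1) + 1 / 2 = (6 * m + 7) / 2 by ring]
  generalize cubicCoeff m k = c
  field_simp
  ring

lemma summable_cubicBound : Summable fun k : ℕ => (1 + 8 * (k : ℝ)) * (1 / 4) ^ k := by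
  have h0 : Summable fun k : ℕ => ((1 / 4 : ℝ)) ^ k :=
    summable_geometric_of_lt_one (by norm_num) (by norm_num)
  have h1 : Summable fun k : ℕ => (k : ℝ) ^ 1 * (1 / 4 : ℝ) ^ k :=
    summable_pow_mul_geometric_of_norm_lt_one 1 (by norm_num)
  refine (h0.add (h1.mul_left 8)).congr fun k => ?_
  ring

lemma norm_cubicTerm_le (m k : ℕ) : ‖cubicTerm m k‖ ≤ (1 + 8 * (k : ℝ)) * (1 / 4) ^ k := by
  have h := cubicCoeff_nonneg m k
  rw [Real.norm_of_nonneg (by rw [cubicTerm]; positivity), cubicTerm, mul_comm]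
  refine mul_le_mul ?_ (cubicCoeff_le m k) h (by positivity)
  rw [div_le_iff₀ (by positivity)]
  -- The two sides differ by exactly 24mk.
  have : 0 ≤ (m : ℝ) * k := by positivity
  linarith

lemma summable_cubicTerm (m : ℕ) : Summable (cubicTerm m) :=
  .of_norm_bounded summable_cubicBound (norm_cubicTerm_le m)

lemma tendsto_cubicAntidiff (m : ℕ) : Tendsto (cubicAntidiff m) atTop (𝓝 0) := by
  have hs (n : ℕ) : Summable fun k : ℕ => (k : ℝ) ^ n * (1 / 4 : ℝ) ^ k :=
    summable_pow_mul_geometric_of_norm_lt_one n (by norm_num)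
  have h1 := (hs 1).tendsto_atTop_zero
  have h2 := (hs 2).tendsto_atTop_zero
  have h3 : Tendsto (fun k : ℕ => (4 * ((k : ℝ) ^ 2 * (1 / 4 : ℝ) ^ k)
      + 2 * ((k : ℝ) ^ 1 * (1 / 4 : ℝ) ^ k)) * ((3 * (m : ℝ) + 1 / 2) * (3 * m + 3 / 2))⁻¹)
      atTop (𝓝 0) := by
    simpa using ((h2.const_mul 4).add (h1.const_mul 2)).mul_const
      (((3 * (m : ℝ) + 1 / 2) * (3 * m + 3 / 2))⁻¹)
  refine squeeze_zero_norm (fun k => ?_) h3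
  rw [cubicAntidiff, norm_mul, Real.norm_of_nonneg (cubicCoeff_nonneg m k), norm_div, norm_mul,
    Real.norm_of_nonneg (by positivity : (0 : ℝ) ≤ k),
    Real.norm_of_nonneg (by positivity : (0 : ℝ) ≤ (3 * (m : ℝ) + 1 / 2) * (3 * m + 3 / 2))]
  have h4 : ‖4 * (k : ℝ) - 2‖ ≤ 4 * k + 2 := by
    rw [Real.norm_eq_abs, abs_le]
    constructor <;> linarith [(Nat.cast_nonneg k : (0 : ℝ) ≤ k)]
  calc cubicCoeff m k * (k * ‖4 * (k : ℝ) - 2‖ / ((3 * m + 1 / 2) * (3 * m + 3 / 2)))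
      ≤ (1 / 4) ^ k * (k * (4 * k + 2) / ((3 * m + 1 / 2) * (3 * m + 3 / 2))) := by
        gcongr
        exact cubicCoeff_le m k
    _ = _ := by rw [div_eq_mul_inv]; ring

lemma tsum_cubicTerm_eq_mul_succ (m : ℕ) :
    ∑' k, cubicTerm m k
      = (1 - (1 / 6) ^ 2 / ((m : ℝ) + 1) ^ 2) * ∑' k, cubicTerm (m + 1) k := by
  have h : HasSum (fun k => cubicTerm m k
      - (1 - (1 / 6) ^ 2 / ((m : ℝ) + 1) ^ 2) * cubicTerm (m + 1) k)
      (∑' k, cubicTerm m k - (1 - (1 / 6) ^ 2 / ((m : ℝ) + 1) ^ 2) * ∑' k, cubicTerm (m + 1) k) :=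
    (summable_cubicTerm m).hasSum.sub ((summable_cubicTerm (m + 1)).hasSum.mul_left _)
  have h' := h.tendsto_sum_nat
  simp only [cubicAntidiff_succ_sub, Finset.sum_range_sub] at h'
  have h0 : cubicAntidiff m 0 = 0 := by simp [cubicAntidiff]
  rw [h0] at h'
  simp only [sub_zero] at h'
  linarith [tendsto_nhds_unique h' (tendsto_cubicAntidiff m)]

lemma tsum_cubicTerm_zero_eq_prod_mul (n : ℕ) :
    ∑' k, cubicTerm 0 k
      = (∏ j ∈ Finset.range n, (1 - (1 / 6 : ℝ) ^ 2 / ((j : ℝ) + 1) ^ 2)) *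
        ∑' k, cubicTerm n k := by
  induction n with
  | zero => simp
  | succ n ih => rw [ih, Finset.prod_range_succ, tsum_cubicTerm_eq_mul_succ n, mul_assoc]

lemma centralBinom_succ_cast (k : ℕ) :
    (Nat.centralBinom (k + 1) : ℝ) = Nat.centralBinom k * (2 * (2 * k + 1) / (k + 1)) := by
  have h : ((k : ℝ) + 1) * Nat.centralBinom (k + 1) = 2 * (2 * k + 1) * Nat.centralBinom k :=
    mod_cast Nat.succ_mul_centralBinom_succ k
  field_simp
  linarith

lemma tendsto_add_div_add_natCast (a b : ℝ) :
    Tendsto (fun m : ℕ => (3 * (m : ℝ) + a) / (m + b)) atTop (𝓝 3) := by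
  have h (c : ℝ) : Tendsto (fun m : ℕ => c / (m : ℝ)) atTop (𝓝 0) :=
    tendsto_const_div_atTop_nhds_zero_nat c
  have h' : Tendsto (fun m : ℕ => (3 + a / (m : ℝ)) / (1 + b / m)) atTop (𝓝 ((3 + 0) / (1 + 0))) :=
    ((h a).const_add 3).div ((h b).const_add 1) (by norm_num)
  rw [add_zero, add_zero, div_one] at h'
  refine h'.congr' ?_
  filter_upwards [eventually_gt_atTop 0] with m hm
  have hm' : (m : ℝ) ≠ 0 := by positivity
  rw [← mul_div_mul_right _ _ hm', add_mul, add_mul, div_mul_cancel₀ _ hm', div_mul_cancel₀ _ hm',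
    one_mul]

/-- As m → ∞ the ratio tends to 9(k + 1/2)/(36(k + 1)), that of C(2k,k)/16ᵏ. -/
lemma tendsto_cubicCoeff (k : ℕ) :
    Tendsto (fun m => cubicCoeff m k) atTop (𝓝 (Nat.centralBinom k / 16 ^ k)) := by
  induction k with
  | zero => simp [cubicCoeff_zero]
  | succ k ih =>
    have h := ih.mul (((tendsto_add_div_add_natCast (1 / 2 + 2 * k) (1 + k)).mul
      (tendsto_add_div_add_natCast (3 / 2 + 2 * k) (1 + k))).mul_const
        (((k : ℝ) + 1 / 2) / (36 * (k + 1))))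
    convert h using 1
    · funext m
      rw [cubicCoeff_succ, div_mul_div_comm, div_mul_div_comm]
      congr 2 <;> ring
    · congr 1
      rw [centralBinom_succ_cast, pow_succ]
      field_simp
      ring

lemma tendsto_cubicTerm (k : ℕ) :
    Tendsto (fun m => cubicTerm m k) atTop (𝓝 (Nat.centralBinom k / 16 ^ k)) := by
  have h : Tendsto (fun m : ℕ => (3 * (m : ℝ) + 1 / 2 + 4 * k) / (3 * m + 1 / 2)) atTop (𝓝 1) := by
    have h' := (tendsto_add_div_add_natCast (1 / 2 + 4 * k) (1 / 6)).div_const 3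
    rw [div_self three_ne_zero] at h'
    refine h'.congr fun m => ?_
    rw [div_div]
    congr 1 <;> ring
  simpa [cubicTerm] using (tendsto_cubicCoeff k).mul h

lemma ringChoose_succ (a : ℝ) (k : ℕ) :
    Ring.choose a (k + 1) = Ring.choose a k * ((a - k) / (k + 1)) := by
  rw [Ring.choose_eq_smul, Ring.choose_eq_smul, descPochhammer_succ_right, Polynomial.smeval_mul,
    Nat.factorial_succ]
  simp only [smul_eq_mul, Polynomial.smeval_sub, Polynomial.smeval_X, Polynomial.smeval_natCast]
  push_cast
  simp
  field_simp

lemma tsum_centralBinom_div :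
    ∑' k : ℕ, (Nat.centralBinom k : ℝ) / 16 ^ k = 2 / √3 := by
  -- The sum is the binomial series of (1 + x)^(-1/2) at x = -1/4.
  have hmem : (-1 / 4 : ℝ) ∈ Metric.eball (0 : ℝ) 1 := by
    rw [Metric.mem_eball, edist_zero_right, ← ofReal_norm, ENNReal.ofReal_lt_one]
    norm_num
  have h := (Real.one_add_rpow_hasFPowerSeriesOnBall_zero (a := -1 / 2)).hasSum hmem
  have hc (k : ℕ) : binomialSeries ℝ (-1 / 2 : ℝ) k (fun _ => (-1 / 4 : ℝ))
      = Nat.centralBinom k / 16 ^ k := by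
    rw [binomialSeries_apply]
    simp only [List.ofFn_const, List.prod_replicate, smul_eq_mul]
    induction k with
    | zero => simp
    | succ k ih =>
      rw [ringChoose_succ, pow_succ, centralBinom_succ_cast, pow_succ,
        mul_mul_mul_comm, ih]
      field_simp
      ring
  simp only [hc] at h
  rw [h.tsum_eq, zero_add, show (1 + -1 / 4 : ℝ) = 3 / 4 by norm_num,
    show (-1 / 2 : ℝ) = -(1 / 2) by norm_num, Real.rpow_neg (by norm_num), ← Real.sqrt_eq_rpow,
    Real.sqrt_div (by norm_num), show (4 : ℝ) = 2 ^ 2 by norm_num, Real.sqrt_sq (by norm_num),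
    inv_div]

lemma tendsto_tsum_cubicTerm :
    Tendsto (fun m => ∑' k, cubicTerm m k) atTop (𝓝 (2 / √3)) := by
  rw [← tsum_centralBinom_div]
  exact tendsto_tsum_of_dominated_convergence summable_cubicBound tendsto_cubicTerm
    (.of_forall fun m k => norm_cubicTerm_le m k)

lemma tendsto_prod_one_sub_sq :
    Tendsto (fun n : ℕ => ∏ j ∈ Finset.range n, (1 - (1 / 6 : ℝ) ^ 2 / ((j : ℝ) + 1) ^ 2))
      atTop (𝓝 (3 / Real.pi)) := by
  have h := (Real.tendsto_euler_sin_prod (1 / 6)).const_mul (Real.pi * (1 / 6))⁻¹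
  have hpi := Real.pi_ne_zero
  simp only [inv_mul_cancel_left₀ (show Real.pi * (1 / 6) ≠ 0 by positivity)] at h
  convert h using 2
  rw [mul_one_div, Real.sin_pi_div_six]
  field_simp
  norm_num

lemma tsum_cubicTerm_zero : ∑' k, cubicTerm 0 k = 2 * √3 / Real.pi := by
  have h := tendsto_prod_one_sub_sq.mul tendsto_tsum_cubicTerm
  simp only [← tsum_cubicTerm_zero_eq_prod_mul] at h
  rw [tendsto_nhds_unique tendsto_const_nhds h]
  have hpi := Real.pi_ne_zero
  have h3 : √3 ^ 2 = (3 : ℝ) := Real.sq_sqrt (by norm_num)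
  field_simp
  rw [h3]

lemma cubicCoeff_zero_left (k : ℕ) :
    cubicCoeff 0 k = (Nat.centralBinom (2 * k) : ℝ) * (Nat.centralBinom k : ℝ) ^ 2
      / ((2 : ℝ) ^ (8 * k) * (3 : ℝ) ^ (2 * k)) := by
  induction k with
  | zero => simp [cubicCoeff_zero]
  | succ k ih =>
    rw [cubicCoeff_succ, ih, show 2 * (k + 1) = 2 * k + 1 + 1 by ring, centralBinom_succ_cast,
      centralBinom_succ_cast, centralBinom_succ_cast, show 8 * (k + 1) = 8 * k + 8 by ring,
      pow_add, pow_succ (3 : ℝ), pow_succ (3 : ℝ)]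
    push_cast
    field_simp
    ring

theorem theorem1 :
    HasSum (fun k : ℕ =>
      ((Nat.choose (4 * k) (2 * k) : ℝ) * (Nat.choose (2 * k) k : ℝ) ^ 2)
        / ((2 : ℝ) ^ (8 * k) * (3 : ℝ) ^ (2 * k)) * (8 * (k : ℝ) + 1))
      (2 * Real.sqrt 3 / Real.pi) := by
  rw [← tsum_cubicTerm_zero]
  convert (summable_cubicTerm 0).hasSum using 2 with k
  rw [cubicTerm, cubicCoeff_zero_left, Nat.centralBinom_eq_two_mul_choose,
    Nat.centralBinom_eq_two_mul_choose, ← mul_assoc]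
  -- At m = 0 the well-poised factor is (1/2 + 4k)/(1/2) = 8k + 1.
  norm_num
  left
  ring
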